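/- **Theorem (Distributionally robust linear regression).** Let $n\ge 0$, $N\ge 1$, let $\|\cdot\|$ be any norm on $\mathbb R^{n+1}=\mathbb R^n\times\mathbb R$ with dual norm $\|z\|_*=\sup\{\langle z,z'\rangle:\|z'\|\le 1\}$, let $\Xi\subseteq\mathbb R^{n+1}$ be closed and convex, let $(\widehat x_i,\widehat y_i)\in\Xi$, $i=1,\dots,N$, be training samples with empirical distribution $\widehat{\mathbb P}_N=\frac1N\sum_{i=1}^N\delta_{(\widehat x_i,\widehat y_i)}$, let $\rho\ge 0$, and let $L:\mathbb R\to\mathbb R$ be convex. For probability distributions $\mathbb Q,\mathbb Q'$ put $W(\mathbb Q,\mathbb Q')=\inf_\Pi\int\|\xi-\xi'\|\,\Pi(d\xi,d\xi')$, the infimum running over all joint distributions $\Pi$ with marginals $\mathbb Q$ and $\mathbb Q'$, and let $\mathbb B_\rho(\widehat{\mathbb P}_N)$ be the set of all probability distributions $\mathbb Q$ with $\mathbb Q(\Xi)=1$ and $W(\mathbb Q,\widehat{\mathbb P}_N)\le\rho$. Consider the distributionally robust regression problem $$\inf_{w\in\mathbb R^n}\ \sup_{\mathbb Q\in\mathbb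 B_\rho(\widehat{\mathbb P}_N)}\mathbb E^{\mathbb Q}\big[L(\langle w,x\rangle-y)\big].\tag{P}$$ (i) If $L(z)=\max_{j\le J}\{a_jz+b_j\}$ for all $z$, then (P) is equivalent to the finite-dimensional convex program $$\begin{aligned}\inf_{w,\lambda,s_i,p_{ij},u_{ij}}\ &\lambda\rho+\frac1N\sum_{i=1}^N s_i\\ \text{s.t. }& S_\Xi(a_jw-p_{ij},\,-a_j-u_{ij})+b_j+\langle p_{ij},\widehat x_i\rangle+u_{ij}\widehat y_i\le s_i && i\le N,\ j\le J,\\ &\|(p_{ij},u_{ij})\|_*\le\lambda && i\le N,\ j\le J,\end{aligned}$$ where $S_\Xi(z)=\sup_{\xi\in\Xi}\langle \xi,z\rangle\in(-\infty,\infty]$ is the support function of $\Xi$. (ii) If $\Xi=\mathbb R^{n+1}$ and $L$ is Lipschitz continuous, with Lipschitz modulus $\mathrm{lip}(L)=\sup_{t\ne t'}|L(t)-L(t')|/|t-t'|$, then (P) is equivalent to the finite-dimensional convex program $$\inf_{w\in\mathbb R^n}\ \frac1N\sum_{i=1}^N L(\langle w,\widehat x_i\rangle-\widehat y_i)+\rho\,\mathrm{lip}(L)\,\|(w,-1)\|_*.$$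 Here "equivalent" means that, in both cases, the expectations in (P) exist and are finite; for every fixed $w$ the inner supremum in (P) equals the objective of the new problem at $w$ (in (i): the infimum over the remaining variables $\lambda,s_i,p_{ij},u_{ij}$); the optimal values (possibly $-\infty$) coincide; and $w$ is optimal in (P) if and only if it is optimal in the new problem (in (i): if and only if it is the $w$-component of an optimal solution). "Convex program" means that the feasible set and the objective function are convex. -/

import Mathlib

open MeasureTheory
open scoped ENNReal

noncomputable section

namespace RobustRegression

/-- The input-output space `ℝⁿ × ℝ = ℝⁿ⁺¹`. The product carries the usual topology and Borel
σ-algebra; the norm used for transportation is a separate datum. -/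
abbrev Sample (n : ℕ) : Type := EuclideanSpace ℝ (Fin n) × ℝ

/-- The standard inner product `⟨x, x'⟩ + y y'` on `ℝⁿ⁺¹`. -/
def pairing {n : ℕ} (z z' : Sample n) : ℝ := inner ℝ z.1 z'.1 + z.2 * z'.2

/-- The dual norm `‖z‖_* = sup {⟨z, z'⟩ : ‖z'‖ ≤ 1}`. -/
def dualNorm {n : ℕ} (ν : Seminorm ℝ (Sample n)) (z : Sample n) : ℝ :=
  sSup {t : ℝ | ∃ z' : Sample n, ν z' ≤ 1 ∧ t = pairing z z'}

/-- The extended-real-valued support function `S_Ξ(z) = sup {⟨ξ, z⟩ : ξ ∈ Ξ}`. -/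
def supportFunction {n : ℕ} (Ξ : Set (Sample n)) (z : Sample n) : EReal :=
  ⨆ ξ ∈ Ξ, ((pairing ξ z : ℝ) : EReal)

/-- The Lipschitz modulus `lip(L) = sup {|L t - L t'| / |t - t'| : t ≠ t'}`. -/
def lipModulus (L : ℝ → ℝ) : ℝ :=
  sSup {r : ℝ | ∃ t t' : ℝ, t ≠ t' ∧ r = |L t - L t'| / |t - t'|}

/-- The Wasserstein distance with transportation cost `d`: the infimum of `∫ d dπ` over all
joint distributions `π` with marginals `Q` and `Q'`. -/
def wasserstein {Ω : Type*} [MeasurableSpace Ω] (d : Ω → Ω → ℝ) (Q Q' : Measure Ω) : ℝ≥0∞ :=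
  ⨅ (π : Measure (Ω × Ω)) (_ : π.map Prod.fst = Q) (_ : π.map Prod.snd = Q'),
    ∫⁻ z, ENNReal.ofReal (d z.1 z.2) ∂π

/-- The uniform distribution on the data points `ξ̂ 1, …, ξ̂ N`. -/
def empirical {Ω : Type*} [MeasurableSpace Ω] {N : ℕ} (data : Fin N → Ω) : Measure Ω :=
  (N : ℝ≥0∞)⁻¹ • ∑ i, Measure.dirac (data i)

/-- The Wasserstein ball of radius `ρ` around `P`: all probability distributions `Q` with
`Q(Ξ) = 1` and `W(Q, P) ≤ ρ`. -/
def wassersteinBall {Ω : Type*} [MeasurableSpace Ω] (d : Ω → Ω → ℝ) (Ξ : Set Ω)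
    (P : Measure Ω) (ρ : ℝ) : Set (Measure Ω) :=
  {Q | IsProbabilityMeasure Q ∧ Q Ξ = 1 ∧ wasserstein d Q P ≤ ENNReal.ofReal ρ}

/-- The ambiguity set of the regression problem: the Wasserstein ball around the empirical
distribution, for the metric induced by the norm `ν`. -/
def ambiguitySet {n N : ℕ} (ν : Seminorm ℝ (Sample n)) (Ξ : Set (Sample n))
    (data : Fin N → Sample n) (ρ : ℝ) : Set (Measure (Sample n)) :=
  wassersteinBall (fun ξ ξ' => ν (ξ - ξ')) Ξ (empirical data) ρ

/-- The loss `L(⟨w, x⟩ - y)` of the linear hypothesis `w` on the sample `ξ = (x, y)`. -/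
def loss {n : ℕ} (L : ℝ → ℝ) (w : EuclideanSpace ℝ (Fin n)) (ξ : Sample n) : ℝ :=
  L (inner ℝ w ξ.1 - ξ.2)

/-- The worst-case expected loss `sup_Q E^Q[L(⟨w, x⟩ - y)]` over the ambiguity set. -/
def worstCaseLoss {n N : ℕ} (ν : Seminorm ℝ (Sample n)) (Ξ : Set (Sample n))
    (data : Fin N → Sample n) (ρ : ℝ) (L : ℝ → ℝ) (w : EuclideanSpace ℝ (Fin n)) : EReal :=
  ⨆ Q ∈ ambiguitySet ν Ξ data ρ, ((∫ ξ, loss L w ξ ∂Q : ℝ) : EReal)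

/-- Decision variables `(w, λ, s, (p, u))` of the finite program for a piecewise affine loss with
`J` pieces; the last entry stores the pairs `(p i j, u i j)`. -/
abbrev Decision (n N J : ℕ) : Type :=
  EuclideanSpace ℝ (Fin n) × ℝ × (Fin N → ℝ) × (Fin N → Fin J → Sample n)

/-- The feasible set of the finite program for the loss `L z = max_j (a j * z + b j)`. -/
def feasibleSet {n N J : ℕ} (ν : Seminorm ℝ (Sample n)) (Ξ : Set (Sample n))
    (data : Fin N → Sample n) (a b : Fin J → ℝ) : Set (Decision n N J) :=
  {v | ∀ (i : Fin N) (j : Fin J),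
    let w := v.1
    let lam := v.2.1
    let s := v.2.2.1
    let p := (v.2.2.2 i j).1
    let u := (v.2.2.2 i j).2
    supportFunction Ξ (a j • w - p, -a j - u)
        + ((b j + inner ℝ p (data i).1 + u * (data i).2 : ℝ) : EReal) ≤ ((s i : ℝ) : EReal)
      ∧ dualNorm ν (p, u) ≤ lam}

/-- The objective `λ ρ + (1/N) ∑ s i` of the finite program. -/
def objective {n N J : ℕ} (ρ : ℝ) (v : Decision n N J) : ℝ :=
  v.2.1 * ρ + (1 / (N : ℝ)) * ∑ i, v.2.2.1 i

/-- The regularized empirical loss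
`(1/N) ∑ L(⟨w, x̂ i⟩ - ŷ i) + ρ lip(L) ‖(w, -1)‖_*`. -/
def regularizedLoss {n N : ℕ} (ν : Seminorm ℝ (Sample n)) (data : Fin N → Sample n)
    (ρ : ℝ) (L : ℝ → ℝ) (w : EuclideanSpace ℝ (Fin n)) : ℝ :=
  (1 / (N : ℝ)) * ∑ i, loss L w (data i) + ρ * lipModulus L * dualNorm ν (w, -1)

end RobustRegression

end

/-!
Both reformulations rest on strong duality for Wasserstein balls around an empirical measure. If
`f ξ ≤ s i + lam ν (ξ - data i)` on `Ξ` for every `i`, integrating along a nearly optimal coupling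
bounds every expectation of `f` over the ambiguity set by `lam ρ + (1/N) ∑ s i`
(`integral_le_of_mem_ambiguitySet`). Conversely, couplings can be mixed, so for Lipschitz `f` the
worst-case expectation is a concave, monotone and finite function of the radius. A supergradient
`lam` of it at `ρ > 0`, tested against the empirical measures of displaced data points, yields
numbers `s i` for which the bound is attained (`exists_dual_isLUB`). Couplings need not be
disintegrated, and the optimal multiplier is obtained along with the value.

For a piecewise affine loss, the conic majorant `s i + lam ν (ξ - data i)` dominates each affine
piece on the convex set `Ξ`. Separating the strict epigraph of the cone from the hypograph of the piece
over `Ξ` produces the vector `(p i j, u i j)` of dual norm at most `lam`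
(`exists_dualNorm_le_of_affine_le`), and feasible points give back conic majorants. So for each `w`
the finite program attains the worst-case loss, which gives equality of values and of minimizers.

For a Lipschitz loss on the whole space, a conic majorant with multiplier `lam` bounds the growth of
the convex function `L` in both directions, which forces `lip(L) ‖(w, -1)‖_* ≤ lam`
(`lipModulus_mul_dualNorm_le`), while `ξ = data i` gives `s i ≥ L(⟨w, x̂ i⟩ - ŷ i)`. Thus no dual
value is below the regularized loss, which is itself the dual value of the multiplier
`lip(L) ‖(w, -1)‖_*`.
-/

namespace RobustRegression

/-! ### The pairing, the norm and its dual -/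

section Geometry

variable {n : ℕ}

lemma pairing_comm (z z' : Sample n) : pairing z z' = pairing z' z := by
  simp only [pairing, real_inner_comm, mul_comm]

lemma pairing_add_right (z z₁ z₂ : Sample n) :
    pairing z (z₁ + z₂) = pairing z z₁ + pairing z z₂ := by
  simp only [pairing, Prod.fst_add, Prod.snd_add, inner_add_right]; ring

lemma pairing_smul_right (c : ℝ) (z z' : Sample n) : pairing z (c • z') = c * pairing z z' := by
  simp only [pairing, Prod.smul_fst, Prod.smul_snd, inner_smul_right, smul_eq_mul]; ring

lemma pairing_sub_right (z z₁ z₂ : Sample n) :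
    pairing z (z₁ - z₂) = pairing z z₁ - pairing z z₂ := by
  simp only [pairing, Prod.fst_sub, Prod.snd_sub, inner_sub_right]; ring

lemma pairing_add_left (z₁ z₂ z : Sample n) :
    pairing (z₁ + z₂) z = pairing z₁ z + pairing z₂ z := by
  simp only [pairing_comm _ z, pairing_add_right]

lemma pairing_smul_left (c : ℝ) (z z' : Sample n) : pairing (c • z) z' = c * pairing z z' := by
  simp only [pairing_comm _ z', pairing_smul_right]

lemma pairing_sub_left (z₁ z₂ z : Sample n) :
    pairing (z₁ - z₂) z = pairing z₁ z - pairing z₂ z := by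
  simp only [pairing_comm _ z, pairing_sub_right]

/-- Every linear functional on `ℝⁿ⁺¹` is given by the pairing with some vector. -/
lemma exists_pairing_eq (g : Sample n →L[ℝ] ℝ) : ∃ p : Sample n, ∀ z, g z = pairing p z := by
  refine ⟨((InnerProductSpace.toDual ℝ _).symm
    (g.comp (ContinuousLinearMap.inl ℝ _ ℝ)), g (0, 1)), fun z => ?_⟩
  have h : z = ContinuousLinearMap.inl ℝ _ ℝ z.1 + z.2 • ((0, 1) : Sample n) := by
    ext <;> simp
  simp only [pairing, InnerProductSpace.toDual_symm_apply, ContinuousLinearMap.comp_apply]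
  conv_lhs => rw [h, map_add, map_smul, smul_eq_mul, mul_comm]

lemma continuous_seminorm (ν : Seminorm ℝ (Sample n)) : Continuous ν := by
  have h := ν.convexOn.continuousOn_interior
  rwa [interior_univ, continuousOn_univ] at h

/-- On a finite-dimensional space every norm dominates the standard one. -/
lemma exists_norm_le_mul (ν : Seminorm ℝ (Sample n)) (hν : ∀ v, ν v = 0 → v = 0) :
    ∃ c : ℝ, 0 ≤ c ∧ ∀ z, ‖z‖ ≤ c * ν z := by
  have hne : (Metric.sphere (0 : Sample n) 1).Nonempty := ⟨(0, 1), by simp [Prod.norm_def]⟩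
  obtain ⟨z₀, hz₀, hmin⟩ := (isCompact_sphere (0 : Sample n) 1).exists_isMinOn hne
    (continuous_seminorm ν).continuousOn
  have hz₀ne : z₀ ≠ 0 := by
    rintro rfl
    simp at hz₀
  have hpos : 0 < ν z₀ := lt_of_le_of_ne (apply_nonneg ν z₀) fun h => hz₀ne (hν _ h.symm)
  refine ⟨(ν z₀)⁻¹, (inv_pos.2 hpos).le, fun z => ?_⟩
  rcases eq_or_ne z 0 with rfl | hz
  · simp
  have hz' : 0 < ‖z‖ := norm_pos_iff.2 hz
  have h : ν z₀ ≤ ν (‖z‖⁻¹ • z) := hmin (by simp [norm_smul, hz'.ne'])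
  rw [map_smul_eq_mul, norm_inv, norm_norm, inv_mul_eq_div, le_div_iff₀ hz'] at h
  rwa [inv_mul_eq_div, le_div_iff₀ hpos, mul_comm]

lemma bddAbove_dualNorm (ν : Seminorm ℝ (Sample n)) (hν : ∀ v, ν v = 0 → v = 0) (z : Sample n) :
    BddAbove {t : ℝ | ∃ z' : Sample n, ν z' ≤ 1 ∧ t = pairing z z'} := by
  obtain ⟨c, hc, h⟩ := exists_norm_le_mul ν hν
  refine ⟨(‖z.1‖ + |z.2|) * c, ?_⟩
  rintro _ ⟨z', hz', rfl⟩
  have hz'c : ‖z'‖ ≤ c := (h z').trans (mul_le_of_le_one_right hc hz')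
  have h1 : inner ℝ z.1 z'.1 ≤ ‖z.1‖ * c := (real_inner_le_norm _ _).trans
    (mul_le_mul_of_nonneg_left ((norm_fst_le z').trans hz'c) (norm_nonneg _))
  have h2 : z.2 * z'.2 ≤ |z.2| * c := (le_abs_self _).trans <| by
    rw [abs_mul]
    exact mul_le_mul_of_nonneg_left ((norm_snd_le z').trans hz'c) (abs_nonneg _)
  calc pairing z z' ≤ ‖z.1‖ * c + |z.2| * c := add_le_add h1 h2
    _ = _ := by ring

lemma dualNorm_le_iff (ν : Seminorm ℝ (Sample n)) (hν : ∀ v, ν v = 0 → v = 0) (z : Sample n)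
    (r : ℝ) : dualNorm ν z ≤ r ↔ ∀ z', ν z' ≤ 1 → pairing z z' ≤ r := by
  rw [dualNorm, csSup_le_iff (bddAbove_dualNorm ν hν z) ⟨_, 0, by simp, rfl⟩]
  exact ⟨fun h z' hz' => h _ ⟨z', hz', rfl⟩, by rintro h _ ⟨z', hz', rfl⟩; exact h z' hz'⟩

lemma dualNorm_nonneg (ν : Seminorm ℝ (Sample n)) (hν : ∀ v, ν v = 0 → v = 0) (z : Sample n) :
    0 ≤ dualNorm ν z := by
  have h := (dualNorm_le_iff ν hν z _).1 le_rfl 0 (by simp)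
  simpa [pairing] using h

lemma pairing_le_dualNorm_mul (ν : Seminorm ℝ (Sample n)) (hν : ∀ v, ν v = 0 → v = 0)
    (z z' : Sample n) : pairing z z' ≤ dualNorm ν z * ν z' := by
  rcases eq_or_lt_of_le (apply_nonneg ν z') with h | h
  · rw [hν z' h.symm]
    simp [pairing]
  · have := (dualNorm_le_iff ν hν z _).1 le_rfl ((ν z')⁻¹ • z') (by
      rw [map_smul_eq_mul, norm_inv, Real.norm_of_nonneg h.le, inv_mul_cancel₀ h.ne'])
    rwa [pairing_smul_right, inv_mul_eq_div, div_le_iff₀ h] at this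

lemma abs_pairing_le_dualNorm_mul (ν : Seminorm ℝ (Sample n)) (hν : ∀ v, ν v = 0 → v = 0)
    (z z' : Sample n) : |pairing z z'| ≤ dualNorm ν z * ν z' := by
  refine abs_le'.2 ⟨pairing_le_dualNorm_mul ν hν z z', ?_⟩
  have h := pairing_le_dualNorm_mul ν hν z ((-1 : ℝ) • z')
  rw [pairing_smul_right, map_smul_eq_mul] at h
  simpa using h

lemma convexOn_dualNorm (ν : Seminorm ℝ (Sample n)) (hν : ∀ v, ν v = 0 → v = 0) :
    ConvexOn ℝ Set.univ (dualNorm ν) := by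
  refine ⟨convex_univ, fun z₁ _ z₂ _ α β hα hβ _ => ?_⟩
  refine (dualNorm_le_iff ν hν _ _).2 fun z' hz' => ?_
  rw [pairing_add_left, pairing_smul_left, pairing_smul_left]
  exact add_le_add
    (mul_le_mul_of_nonneg_left ((dualNorm_le_iff ν hν _ _).1 le_rfl z' hz') hα)
    (mul_le_mul_of_nonneg_left ((dualNorm_le_iff ν hν _ _).1 le_rfl z' hz') hβ)

/-- Sandwich theorem: if on a convex set an affine function lies below `s + r ν (· - ξ₀)`, then
part of its slope, of dual norm at most `r`, can be split off so that the affine function obtained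
by freezing that part at `ξ₀` stays below `s`. The vector `p` comes from separating the strict
epigraph of `r ν (· - ξ₀)` from the hypograph of the affine function over the convex set. -/
lemma exists_dualNorm_le_of_affine_le (ν : Seminorm ℝ (Sample n)) (hν : ∀ v, ν v = 0 → v = 0)
    {Ξ : Set (Sample n)} (hΞ : Convex ℝ Ξ) (hne : Ξ.Nonempty) (ξ₀ c : Sample n) {b s r : ℝ}
    (hr : 0 ≤ r) (h : ∀ ξ ∈ Ξ, pairing c ξ + b ≤ s + r * ν (ξ - ξ₀)) :
    ∃ p : Sample n, dualNorm ν p ≤ r ∧ ∀ ξ ∈ Ξ, pairing (c - p) ξ + (b + pairing p ξ₀) ≤ s := by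
  have hconv : ConvexOn ℝ Set.univ fun ξ : Sample n => r * ν (ξ - ξ₀) := by
    have h1 := (ν.convexOn.translate_left (c := -ξ₀)).smul hr
    simpa [Function.comp_def, sub_eq_add_neg, add_comm] using h1
  have hcont : Continuous fun ξ : Sample n => r * ν (ξ - ξ₀) :=
    continuous_const.mul ((continuous_seminorm ν).comp (continuous_id.sub continuous_const))
  have hA : Convex ℝ {q : Sample n × ℝ | r * ν (q.1 - ξ₀) < q.2} := by
    simpa using hconv.convex_strict_epigraph
  have hAo : IsOpen {q : Sample n × ℝ | r * ν (q.1 - ξ₀) < q.2} :=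
    isOpen_lt (hcont.comp continuous_fst) continuous_snd
  have hB : Convex ℝ {q : Sample n × ℝ | q.1 ∈ Ξ ∧ q.2 ≤ pairing c q.1 + b - s} := by
    rintro ⟨ξ₁, t₁⟩ ⟨h1, h1'⟩ ⟨ξ₂, t₂⟩ ⟨h2, h2'⟩ α β hα hβ hαβ
    refine ⟨hΞ h1 h2 hα hβ hαβ, ?_⟩
    simp only [Prod.smul_mk, Prod.mk_add_mk, smul_eq_mul, pairing_add_right,
      pairing_smul_right] at h1' h2' ⊢
    have e : b - s = α * (b - s) + β * (b - s) := by rw [← add_mul, hαβ, one_mul]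
    have h3 := mul_le_mul_of_nonneg_left h1' hα
    have h4 := mul_le_mul_of_nonneg_left h2' hβ
    linarith
  have hdisj : Disjoint {q : Sample n × ℝ | r * ν (q.1 - ξ₀) < q.2}
      {q : Sample n × ℝ | q.1 ∈ Ξ ∧ q.2 ≤ pairing c q.1 + b - s} := by
    refine Set.disjoint_left.2 ?_
    rintro ⟨ξ, t⟩ h1 ⟨h2, h3⟩
    have h4 := h ξ h2
    simp only [Set.mem_ofPred_eq] at h1 h3
    linarith
  obtain ⟨f, u, hfA, hfB⟩ := geometric_hahn_banach_open hA hAo hB hdisj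
  set τ : ℝ := f (0, 1) with hτ
  have hf : ∀ ξ t, f (ξ, t) = f (ξ, 0) + t * τ := fun ξ t => by
    have e : ((ξ, t) : Sample n × ℝ) = (ξ, 0) + t • ((0 : Sample n), (1 : ℝ)) := by simp
    rw [e, map_add, map_smul, smul_eq_mul]
  have hA' : ∀ ξ t, r * ν (ξ - ξ₀) < t → f (ξ, 0) + t * τ < u := fun ξ t ht => by
    rw [← hf]; exact hfA _ ht
  have hB' : ∀ ξ ∈ Ξ, u ≤ f (ξ, 0) + (pairing c ξ + b - s) * τ := fun ξ hξ => by
    rw [← hf]; exact hfB _ ⟨hξ, le_rfl⟩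
  have hτneg : τ < 0 := by
    -- a point of `Ξ` lies under a point of the epigraph, so the hyperplane is not vertical
    obtain ⟨ξ, hξ⟩ := hne
    have h1 := hB' ξ hξ
    have h2 := hA' ξ (r * ν (ξ - ξ₀) + 1) (by linarith)
    have h3 := h ξ hξ
    by_contra hcon
    have h4 := mul_le_mul_of_nonneg_right
      (show pairing c ξ + b - s ≤ r * ν (ξ - ξ₀) + 1 by linarith) (not_lt.1 hcon)
    linarith
  obtain ⟨p, hp⟩ := exists_pairing_eq
    ((-τ)⁻¹ • f.comp (ContinuousLinearMap.inl ℝ (Sample n) ℝ))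
  have hp' : ∀ ξ, f (ξ, 0) = -τ * pairing p ξ := fun ξ => by
    rw [← hp]
    simp only [smul_apply, ContinuousLinearMap.comp_apply,
      ContinuousLinearMap.inl_apply, smul_eq_mul]
    rw [mul_inv_cancel_left₀ (neg_ne_zero.2 hτneg.ne)]
  -- dividing by `-τ`, the separating hyperplane becomes the graph of `pairing p · - u / (-τ)`
  have hA'' : ∀ ξ, pairing p ξ - r * ν (ξ - ξ₀) ≤ u / -τ := fun ξ => by
    refine le_of_forall_pos_le_add fun ε hε => ?_
    have h1 := hA' ξ (r * ν (ξ - ξ₀) + ε) (by linarith)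
    rw [hp'] at h1
    have h2 : pairing p ξ - (r * ν (ξ - ξ₀) + ε) < u / -τ := by
      rw [lt_div_iff₀ (by linarith)]; linarith
    linarith
  have hB'' : ∀ ξ ∈ Ξ, u / -τ ≤ pairing p ξ - (pairing c ξ + b - s) := fun ξ hξ => by
    have h1 := hB' ξ hξ
    rw [hp'] at h1
    rw [div_le_iff₀ (by linarith)]; linarith
  have h0 : pairing p ξ₀ ≤ u / -τ := by simpa using hA'' ξ₀
  refine ⟨p, (dualNorm_le_iff ν hν _ _).2 fun z hz => ?_, fun ξ hξ => ?_⟩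
  · -- moving from `ξ₀` arbitrarily far in direction `z` compares the slopes
    by_contra hcon
    have hd : 0 < pairing p z - r * ν z := by
      have := mul_le_of_le_one_right hr hz
      linarith
    obtain ⟨k, hk⟩ := exists_nat_gt ((u / -τ - pairing p ξ₀) / (pairing p z - r * ν z))
    rw [div_lt_iff₀ hd] at hk
    have h1 := hA'' (ξ₀ + (k : ℝ) • z)
    rw [add_sub_cancel_left, map_smul_eq_mul, pairing_add_right, pairing_smul_right,
      Real.norm_of_nonneg (Nat.cast_nonneg k)] at h1
    linarith
  · have h1 := hB'' ξ hξ
    rw [pairing_sub_left]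
    linarith

end Geometry

end RobustRegression

namespace RobustRegression

/-! ### Empirical measures and couplings -/

section Couplings

lemma empirical_map {Ω Ω' : Type*} [MeasurableSpace Ω] [MeasurableSpace Ω'] {N : ℕ}
    (data : Fin N → Ω) {g : Ω → Ω'} (hg : Measurable g) :
    (empirical data).map g = empirical fun i => g (data i) := by
  simp only [empirical, Measure.map_smul, Measure.map_finset_sum' hg.aemeasurable,
    Measure.map_dirac' hg]

lemma isProbabilityMeasure_empirical {Ω : Type*} [MeasurableSpace Ω] {N : ℕ} (hN : 1 ≤ N)
    (data : Fin N → Ω) : IsProbabilityMeasure (empirical data) := by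
  refine ⟨?_⟩
  simp only [empirical, Measure.smul_apply, Measure.coe_finsetSum, Finset.sum_apply,
    measure_univ, Finset.sum_const, Finset.card_univ, Fintype.card_fin, nsmul_eq_mul, mul_one,
    smul_eq_mul]
  exact ENNReal.inv_mul_cancel (by simpa using Nat.one_le_iff_ne_zero.1 hN) (by simp)

lemma integrable_empirical {Ω : Type*} [MeasurableSpace Ω] [MeasurableSingletonClass Ω] {N : ℕ}
    (hN : 1 ≤ N) (data : Fin N → Ω) (f : Ω → ℝ) : Integrable f (empirical data) := by
  refine Integrable.smul_measure ?_ (by simpa using Nat.one_le_iff_ne_zero.1 hN)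
  exact integrable_finsetSum_measure.2 fun i _ => integrable_dirac (by simp)

lemma integral_empirical {Ω : Type*} [MeasurableSpace Ω] [MeasurableSingletonClass Ω] {N : ℕ}
    (data : Fin N → Ω) (f : Ω → ℝ) :
    ∫ x, f x ∂empirical data = (1 / (N : ℝ)) * ∑ i, f (data i) := by
  rw [empirical, integral_smul_measure,
    integral_finsetSum_measure fun i _ => integrable_dirac (by simp)]
  simp [integral_dirac]

lemma ae_empirical {Ω : Type*} [MeasurableSpace Ω] [MeasurableSingletonClass Ω] {N : ℕ}
    (data : Fin N → Ω) {p : Ω → Prop} (hp : ∀ i, p (data i)) : ∀ᵐ x ∂empirical data, p x := by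
  refine Measure.ae_smul_measure ?_ _
  rw [ae_iff, Measure.coe_finsetSum, Finset.sum_apply]
  refine Finset.sum_eq_zero fun i _ => ?_
  rw [← ae_iff, ae_dirac_eq]
  exact hp i

variable {n N : ℕ} {ν : Seminorm ℝ (Sample n)} {Ξ : Set (Sample n)} {data : Fin N → Sample n}
  {ρ : ℝ}

lemma measurable_cost (ν : Seminorm ℝ (Sample n)) :
    Measurable fun z : Sample n × Sample n => ν (z.1 - z.2) :=
  (continuous_seminorm ν).measurable.comp (measurable_fst.sub measurable_snd)

/-- The infimum defining the Wasserstein distance need not be attained, but every radius larger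
than `ρ` is met by the expected cost of some coupling. -/
lemma exists_coupling {Q : Measure (Sample n)} (hQ : Q ∈ ambiguitySet ν Ξ data ρ) (hρ : 0 ≤ ρ)
    {r : ℝ} (hr : ρ < r) :
    ∃ π : Measure (Sample n × Sample n), π.map Prod.fst = Q ∧ π.map Prod.snd = empirical data ∧
      Integrable (fun z => ν (z.1 - z.2)) π ∧ ∫ z, ν (z.1 - z.2) ∂π ≤ r := by
  have h : wasserstein (fun ξ ξ' => ν (ξ - ξ')) Q (empirical data) < ENNReal.ofReal r :=
    hQ.2.2.trans_lt ((ENNReal.ofReal_lt_ofReal_iff (hρ.trans_lt hr)).2 hr)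
  simp only [wasserstein, iInf_lt_iff] at h
  obtain ⟨π, h1, h2, h3⟩ := h
  have hnn : 0 ≤ᵐ[π] fun z => ν (z.1 - z.2) := .of_forall fun z => apply_nonneg ν _
  have hm := (measurable_cost ν).aestronglyMeasurable (μ := π)
  refine ⟨π, h1, h2, ⟨hm, ?_⟩, ?_⟩
  · rw [hasFiniteIntegral_iff_ofReal hnn]
    exact h3.trans ENNReal.ofReal_lt_top
  · rw [integral_eq_lintegral_of_nonneg_ae hnn hm]
    exact ENNReal.toReal_le_of_le_ofReal (hρ.trans hr.le) h3.le

lemma mem_ambiguitySet_of_coupling {Q : Measure (Sample n)} [IsProbabilityMeasure Q] (hQ : Q Ξ = 1)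
    (π : Measure (Sample n × Sample n)) (h1 : π.map Prod.fst = Q)
    (h2 : π.map Prod.snd = empirical data) (hi : Integrable (fun z => ν (z.1 - z.2)) π)
    (h3 : ∫ z, ν (z.1 - z.2) ∂π ≤ ρ) : Q ∈ ambiguitySet ν Ξ data ρ := by
  refine ⟨inferInstance, hQ, iInf₂_le_of_le π h1 (iInf_le_of_le h2 ?_)⟩
  rw [← ofReal_integral_eq_lintegral_ofReal hi (.of_forall fun z => apply_nonneg ν _)]
  exact ENNReal.ofReal_le_ofReal h3

/-- Moving the `i`-th data point to `ζ i` costs `(1/N) ∑ ν (ζ i - data i)`. -/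
lemma empirical_mem_ambiguitySet (hN : 1 ≤ N) (hΞ : MeasurableSet Ξ) {ζ : Fin N → Sample n}
    (hζ : ∀ i, ζ i ∈ Ξ) :
    empirical ζ ∈ ambiguitySet ν Ξ data ((1 / (N : ℝ)) * ∑ i, ν (ζ i - data i)) := by
  have := isProbabilityMeasure_empirical hN ζ
  refine mem_ambiguitySet_of_coupling ((mem_ae_iff_prob_eq_one hΞ).1 (ae_empirical ζ hζ))
    (empirical fun i => (ζ i, data i)) (empirical_map _ measurable_fst)
    (empirical_map _ measurable_snd) (integrable_empirical hN _ _) ?_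
  rw [integral_empirical]

lemma ambiguitySet_mono {r : ℝ} (h : ρ ≤ r) :
    ambiguitySet ν Ξ data ρ ⊆ ambiguitySet ν Ξ data r :=
  fun _ hQ => ⟨hQ.1, hQ.2.1, hQ.2.2.trans (ENNReal.ofReal_le_ofReal h)⟩

lemma empirical_data_mem_ambiguitySet (hN : 1 ≤ N) (hΞ : MeasurableSet Ξ)
    (hdata : ∀ i, data i ∈ Ξ) (hρ : 0 ≤ ρ) : empirical data ∈ ambiguitySet ν Ξ data ρ :=
  ambiguitySet_mono (by simpa using hρ) (empirical_mem_ambiguitySet hN hΞ hdata)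

/-- A mixture of distributions in two Wasserstein balls lies in the ball whose radius is the mixture
of the radii, because couplings can be mixed. -/
lemma mixture_mem_ambiguitySet {Q₁ Q₂ : Measure (Sample n)} {r₁ r₂ : ℝ}
    (hr₁ : 0 ≤ r₁) (hr₂ : 0 ≤ r₂) (h₁ : Q₁ ∈ ambiguitySet ν Ξ data r₁)
    (h₂ : Q₂ ∈ ambiguitySet ν Ξ data r₂) {α β : ℝ} (hα : 0 ≤ α) (hβ : 0 ≤ β) (hαβ : α + β = 1) :
    ENNReal.ofReal α • Q₁ + ENNReal.ofReal β • Q₂ ∈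
      ambiguitySet ν Ξ data (α * r₁ + β * r₂) := by
  have hsum : ENNReal.ofReal α + ENNReal.ofReal β = 1 := by
    rw [← ENNReal.ofReal_add hα hβ, hαβ, ENNReal.ofReal_one]
  have := h₁.1
  have := h₂.1
  have hQ : IsProbabilityMeasure (ENNReal.ofReal α • Q₁ + ENNReal.ofReal β • Q₂) := by
    refine ⟨?_⟩
    simp [hsum]
  have hQΞ : (ENNReal.ofReal α • Q₁ + ENNReal.ofReal β • Q₂) Ξ = 1 := by
    simp [h₁.2.1, h₂.2.1, hsum]
  have key : ∀ ε : ℝ, 0 < ε → ENNReal.ofReal α • Q₁ + ENNReal.ofReal β • Q₂ ∈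
      ambiguitySet ν Ξ data (α * r₁ + β * r₂ + ε) := fun ε hε => by
    obtain ⟨π₁, a₁, b₁, i₁, c₁⟩ := exists_coupling h₁ hr₁ (lt_add_of_pos_right r₁ hε)
    obtain ⟨π₂, a₂, b₂, i₂, c₂⟩ := exists_coupling h₂ hr₂ (lt_add_of_pos_right r₂ hε)
    have i₁' := i₁.smul_measure (c := ENNReal.ofReal α) ENNReal.ofReal_ne_top
    have i₂' := i₂.smul_measure (c := ENNReal.ofReal β) ENNReal.ofReal_ne_top
    refine mem_ambiguitySet_of_coupling hQΞ (ENNReal.ofReal α • π₁ + ENNReal.ofReal β • π₂)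
      ?_ ?_ (i₁'.add_measure i₂') ?_
    · rw [Measure.map_add _ _ measurable_fst, Measure.map_smul, Measure.map_smul, a₁, a₂]
    · rw [Measure.map_add _ _ measurable_snd, Measure.map_smul, Measure.map_smul, b₁, b₂,
        ← add_smul, hsum, one_smul]
    · rw [integral_add_measure i₁' i₂', integral_smul_measure, integral_smul_measure,
        ENNReal.toReal_ofReal hα, ENNReal.toReal_ofReal hβ, smul_eq_mul, smul_eq_mul]
      have e : ε = α * ε + β * ε := by rw [← add_mul, hαβ, one_mul]
      have d₁ := mul_le_mul_of_nonneg_left c₁ hα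
      have d₂ := mul_le_mul_of_nonneg_left c₂ hβ
      linarith
  refine ⟨hQ, hQΞ, ENNReal.le_of_forall_pos_le_add fun ε hε _ => ?_⟩
  have h := (key ε hε).2.2
  rwa [ENNReal.ofReal_add (by positivity) ε.coe_nonneg, ENNReal.ofReal_coe_nnreal] at h

end Couplings

/-! ### Duality for Wasserstein balls around an empirical measure -/

section Duality

variable {n N : ℕ} {ν : Seminorm ℝ (Sample n)} {Ξ : Set (Sample n)} {data : Fin N → Sample n}
  {ρ : ℝ} {f : Sample n → ℝ} {K : ℝ}

lemma continuous_of_abs_sub_le_mul_seminorm (hf : ∀ ξ ξ', |f ξ - f ξ'| ≤ K * ν (ξ - ξ')) :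
    Continuous f := by
  refine continuous_iff_continuousAt.2 fun ξ => tendsto_iff_norm_sub_tendsto_zero.2 ?_
  refine squeeze_zero (fun _ => norm_nonneg _) (fun ξ' => hf ξ' ξ) ?_
  have h : Continuous fun ξ' => K * ν (ξ' - ξ) :=
    continuous_const.mul ((continuous_seminorm ν).comp (continuous_id.sub continuous_const))
  simpa using h.tendsto ξ

lemma integrable_comp_fst_of_coupling (hN : 1 ≤ N)
    (hf : ∀ ξ ξ', |f ξ - f ξ'| ≤ K * ν (ξ - ξ')) {π : Measure (Sample n × Sample n)}
    (h2 : π.map Prod.snd = empirical data) (hi : Integrable (fun z => ν (z.1 - z.2)) π) :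
    Integrable (fun z => f z.1) π := by
  have hc := continuous_of_abs_sub_le_mul_seminorm hf
  have h : Integrable (fun z : Sample n × Sample n => f z.2) π := by
    have h' := integrable_empirical hN data f
    rw [← h2] at h'
    exact h'.comp_measurable measurable_snd
  refine (h.abs.add (hi.const_mul K)).mono'
    (hc.measurable.comp measurable_fst).aestronglyMeasurable (.of_forall fun z => ?_)
  have h' := abs_sub_abs_le_abs_sub (f z.1) (f z.2)
  have h'' := hf z.1 z.2
  simp only [Real.norm_eq_abs, Pi.add_apply]
  linarith

lemma integrable_of_mem_ambiguitySet (hN : 1 ≤ N) (hρ : 0 ≤ ρ)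
    (hf : ∀ ξ ξ', |f ξ - f ξ'| ≤ K * ν (ξ - ξ')) {Q : Measure (Sample n)}
    (hQ : Q ∈ ambiguitySet ν Ξ data ρ) : Integrable f Q := by
  obtain ⟨π, h1, h2, hi, -⟩ := exists_coupling hQ hρ (lt_add_one ρ)
  rw [← h1]
  exact (integrable_map_measure
    (continuous_of_abs_sub_le_mul_seminorm hf).measurable.aestronglyMeasurable
    measurable_fst.aemeasurable).2 (integrable_comp_fst_of_coupling hN hf h2 hi)

/-- Weak duality: a majorant of `f` on `Ξ` by cones of slope `lam` centred at the data points bounds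
all expectations over the ambiguity set. -/
lemma integral_le_of_mem_ambiguitySet (hN : 1 ≤ N) (hΞ : MeasurableSet Ξ) (hne : Ξ.Nonempty)
    (hρ : 0 ≤ ρ) (hf : ∀ ξ ξ', |f ξ - f ξ'| ≤ K * ν (ξ - ξ')) {lam : ℝ} (hlam : 0 ≤ lam)
    {s : Fin N → ℝ} (hs : ∀ i, ∀ ξ ∈ Ξ, f ξ ≤ s i + lam * ν (ξ - data i))
    {Q : Measure (Sample n)} (hQ : Q ∈ ambiguitySet ν Ξ data ρ) :
    ∫ ξ, f ξ ∂Q ≤ lam * ρ + (1 / (N : ℝ)) * ∑ i, s i := by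
  -- data points may repeat, so the bounds `s i` are replaced by a function of the data point
  set H : Sample n → ℝ := fun ξ' => sSup ((fun ξ => f ξ - lam * ν (ξ - ξ')) '' Ξ) with hH
  have hb : ∀ i, s i ∈ upperBounds ((fun ξ => f ξ - lam * ν (ξ - data i)) '' Ξ) := by
    rintro i _ ⟨ξ, hξ, rfl⟩
    have := hs i ξ hξ
    simp only
    linarith
  have hHs : ∀ i, H (data i) ≤ s i := fun i => csSup_le (hne.image _) (hb i)
  have hfH : ∀ i, ∀ ξ ∈ Ξ, f ξ ≤ H (data i) + lam * ν (ξ - data i) := fun i ξ hξ => by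
    have h : f ξ - lam * ν (ξ - data i) ≤ H (data i) :=
      le_csSup ⟨s i, hb i⟩ ⟨ξ, hξ, rfl⟩
    linarith
  have hsum : (1 / (N : ℝ)) * ∑ i, H (data i) ≤ (1 / (N : ℝ)) * ∑ i, s i :=
    mul_le_mul_of_nonneg_left (Finset.sum_le_sum fun i _ => hHs i) (by positivity)
  have key : ∀ r, ρ < r → ∫ ξ, f ξ ∂Q ≤ lam * r + (1 / (N : ℝ)) * ∑ i, H (data i) := fun r hr => by
    obtain ⟨π, h1, h2, hi, h3⟩ := exists_coupling hQ hρ hr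
    have hfi := integrable_comp_fst_of_coupling hN hf h2 hi
    have hHi := integrable_empirical hN data H
    rw [← h2] at hHi
    have hHi' : Integrable (fun z : Sample n × Sample n => H z.2) π :=
      hHi.comp_measurable measurable_snd
    have ae1 : ∀ᵐ z ∂π, z.1 ∈ Ξ := by
      have := hQ.1
      have h : ∀ᵐ ξ ∂Q, ξ ∈ Ξ := (mem_ae_iff_prob_eq_one hΞ).2 hQ.2.1
      rw [← h1] at h
      exact ae_of_ae_map measurable_fst.aemeasurable h
    have ae2 : ∀ᵐ z ∂π, z.2 ∈ Set.range data := by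
      have h := ae_empirical data (p := (· ∈ Set.range data)) fun i => ⟨i, rfl⟩
      rw [← h2] at h
      exact ae_of_ae_map measurable_snd.aemeasurable h
    have hle : ∀ᵐ z ∂π, f z.1 ≤ lam * ν (z.1 - z.2) + H z.2 := by
      filter_upwards [ae1, ae2] with z hz1 hz2
      obtain ⟨i, hi⟩ := hz2
      rw [← hi, add_comm]
      exact hfH i _ hz1
    calc ∫ ξ, f ξ ∂Q = ∫ z, f z.1 ∂π := by
          rw [← h1, integral_map measurable_fst.aemeasurable
            (continuous_of_abs_sub_le_mul_seminorm hf).measurable.aestronglyMeasurable]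
      _ ≤ ∫ z, (lam * ν (z.1 - z.2) + H z.2) ∂π :=
          integral_mono_ae hfi ((hi.const_mul lam).add hHi') hle
      _ = lam * ∫ z, ν (z.1 - z.2) ∂π + ∫ z, H z.2 ∂π := by
          rw [integral_add (hi.const_mul lam) hHi', integral_const_mul]
      _ = lam * ∫ z, ν (z.1 - z.2) ∂π + (1 / (N : ℝ)) * ∑ i, H (data i) := by
          rw [← integral_empirical data H, ← h2,
            integral_map measurable_snd.aemeasurable hHi.aestronglyMeasurable]
      _ ≤ _ := by
          have := mul_le_mul_of_nonneg_left h3 hlam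
          linarith
  refine le_of_forall_pos_le_add fun ε hε => ?_
  have h := key (ρ + ε / (lam + 1)) (by have : 0 < ε / (lam + 1) := by positivity
                                        linarith)
  have h' : lam * (ε / (lam + 1)) ≤ ε := by
    rw [← mul_div_assoc, div_le_iff₀ (by positivity)]
    nlinarith
  rw [mul_add] at h
  linarith

/-- A monotone concave function on the half-line has a nonnegative supergradient at every interior
point. -/
lemma exists_nonneg_supergradient {φ : ℝ → ℝ} (hφ : ConcaveOn ℝ (Set.Ici 0) φ)
    (hmono : MonotoneOn φ (Set.Ici 0)) (hρ : 0 < ρ) :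
    ∃ lam : ℝ, 0 ≤ lam ∧ ∀ r, 0 ≤ r → φ r ≤ φ ρ + lam * (r - ρ) := by
  have hint : ρ ∈ interior (Set.Ici (0 : ℝ)) := by rwa [interior_Ici]
  have hψ := hφ.neg
  have hright : ∀ r, ρ < r →
      derivWithin (-φ) (Set.Ioi ρ) ρ * (r - ρ) ≤ φ ρ - φ r := fun r hr => by
    have h := ConvexOn.rightDeriv_le_slope_of_mem_interior hψ hint
      (Set.mem_Ici.2 (hρ.trans hr).le) hr
    rw [slope_def_field, le_div_iff₀ (sub_pos.2 hr)] at h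
    simp only [Pi.neg_apply] at h
    linarith
  have hleft : ∀ r, 0 ≤ r → r < ρ →
      derivWithin (-φ) (Set.Ioi ρ) ρ * (r - ρ) ≤ φ ρ - φ r := fun r h0 hr => by
    have h := (ConvexOn.slope_le_leftDeriv_of_mem_interior hψ (Set.mem_Ici.2 h0) hint hr).trans
      (ConvexOn.leftDeriv_le_rightDeriv_of_mem_interior hψ hint)
    rw [slope_def_field, div_le_iff₀ (sub_pos.2 hr)] at h
    simp only [Pi.neg_apply] at h
    linarith
  refine ⟨-derivWithin (-φ) (Set.Ioi ρ) ρ, ?_, fun r hr => ?_⟩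
  · have h1 := hright (ρ + 1) (lt_add_one ρ)
    have h2 := hmono (Set.mem_Ici.2 hρ.le) (Set.mem_Ici.2 (by linarith)) (lt_add_one ρ).le
    linarith
  · rcases lt_trichotomy r ρ with h | rfl | h
    · linarith [hleft r hr h]
    · simp
    · linarith [hright r h]

/-- If a separable sum is bounded over a product set, its summands have upper bounds adding up to at
most the same constant. -/
lemma exists_upperBounds_sum_le {ι α : Type*} [Fintype ι] {S : Set α} (hS : S.Nonempty)
    (g : ι → α → ℝ) {C : ℝ} (h : ∀ ζ : ι → α, (∀ i, ζ i ∈ S) → ∑ i, g i (ζ i) ≤ C) :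
    ∃ s : ι → ℝ, (∀ i, ∀ x ∈ S, g i x ≤ s i) ∧ ∑ i, s i ≤ C := by
  classical
  obtain ⟨x₀, hx₀⟩ := hS
  have hb : ∀ i, BddAbove (g i '' S) := by
    refine fun i => ⟨C - ∑ j ∈ Finset.univ.erase i, g j x₀, ?_⟩
    rintro _ ⟨x, hx, rfl⟩
    have h1 := h (Function.update (fun _ => x₀) i x) fun j => by
      rcases eq_or_ne j i with rfl | hj
      · simpa using hx
      · simpa [hj] using hx₀
    rw [← Finset.add_sum_erase _ _ (Finset.mem_univ i), Function.update_self,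
      Finset.sum_congr rfl fun j hj => by
        rw [Function.update_of_ne (Finset.ne_of_mem_erase hj)]] at h1
    linarith
  refine ⟨fun i => sSup (g i '' S), fun i x hx => le_csSup (hb i) ⟨x, hx, rfl⟩, ?_⟩
  refine le_of_forall_pos_le_add fun ε hε => ?_
  have hε' : 0 < ε / (Fintype.card ι + 1) := by positivity
  have hex : ∀ i, ∃ x ∈ S, sSup (g i '' S) - ε / (Fintype.card ι + 1) < g i x := fun i => by
    obtain ⟨_, ⟨x, hx, rfl⟩, hlt⟩ := exists_lt_of_lt_csSup
      (Set.Nonempty.image (g i) ⟨x₀, hx₀⟩) (sub_lt_self (sSup (g i '' S)) hε')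
    exact ⟨x, hx, hlt⟩
  choose ζ hζ hlt using hex
  have h1 : ∑ i, sSup (g i '' S) ≤ ∑ i, (g i (ζ i) + ε / (Fintype.card ι + 1)) :=
    Finset.sum_le_sum fun i _ => by linarith [hlt i]
  have h2 : (Fintype.card ι : ℝ) * (ε / (Fintype.card ι + 1)) ≤ ε := by
    rw [← mul_div_assoc, div_le_iff₀ (by positivity)]
    nlinarith
  rw [Finset.sum_add_distrib, Finset.sum_const, Finset.card_univ, nsmul_eq_mul] at h1
  linarith [h ζ hζ]

/-- The real-valued worst-case expectation of `f`, as a function of the radius of the ambiguity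
set. -/
noncomputable def worstCaseExpectation (ν : Seminorm ℝ (Sample n)) (Ξ : Set (Sample n))
    (data : Fin N → Sample n) (f : Sample n → ℝ) (r : ℝ) : ℝ :=
  sSup ((fun Q => ∫ ξ, f ξ ∂Q) '' ambiguitySet ν Ξ data r)

lemma integral_le_empirical_add (hN : 1 ≤ N) (hΞ : MeasurableSet Ξ) (hne : Ξ.Nonempty)
    (hρ : 0 ≤ ρ) (hK : 0 ≤ K) (hf : ∀ ξ ξ', |f ξ - f ξ'| ≤ K * ν (ξ - ξ'))
    {Q : Measure (Sample n)} (hQ : Q ∈ ambiguitySet ν Ξ data ρ) :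
    ∫ ξ, f ξ ∂Q ≤ K * ρ + (1 / (N : ℝ)) * ∑ i, f (data i) :=
  integral_le_of_mem_ambiguitySet hN hΞ hne hρ hf hK (fun i ξ _ => by
    linarith [le_abs_self (f ξ - f (data i)), hf ξ (data i)]) hQ

lemma isLUB_worstCaseExpectation (hN : 1 ≤ N) (hΞ : MeasurableSet Ξ) (hdata : ∀ i, data i ∈ Ξ)
    (hρ : 0 ≤ ρ) (hK : 0 ≤ K) (hf : ∀ ξ ξ', |f ξ - f ξ'| ≤ K * ν (ξ - ξ')) :
    IsLUB ((fun Q => ∫ ξ, f ξ ∂Q) '' ambiguitySet ν Ξ data ρ)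
      (worstCaseExpectation ν Ξ data f ρ) := by
  refine isLUB_csSup ⟨_, _, empirical_data_mem_ambiguitySet hN hΞ hdata hρ, rfl⟩
    ⟨K * ρ + (1 / (N : ℝ)) * ∑ i, f (data i), ?_⟩
  rintro _ ⟨Q, hQ, rfl⟩
  exact integral_le_empirical_add hN hΞ ⟨_, hdata ⟨0, hN⟩⟩ hρ hK hf hQ

lemma monotoneOn_worstCaseExpectation (hN : 1 ≤ N) (hΞ : MeasurableSet Ξ)
    (hdata : ∀ i, data i ∈ Ξ) (hK : 0 ≤ K) (hf : ∀ ξ ξ', |f ξ - f ξ'| ≤ K * ν (ξ - ξ')) :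
    MonotoneOn (worstCaseExpectation ν Ξ data f) (Set.Ici 0) := fun _ h₁ _ h₂ h =>
  (isLUB_worstCaseExpectation hN hΞ hdata h₁ hK hf).mono
    (isLUB_worstCaseExpectation hN hΞ hdata h₂ hK hf) (Set.image_mono (ambiguitySet_mono h))

lemma concaveOn_worstCaseExpectation (hN : 1 ≤ N) (hΞ : MeasurableSet Ξ)
    (hdata : ∀ i, data i ∈ Ξ) (hK : 0 ≤ K) (hf : ∀ ξ ξ', |f ξ - f ξ'| ≤ K * ν (ξ - ξ')) :
    ConcaveOn ℝ (Set.Ici 0) (worstCaseExpectation ν Ξ data f) := by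
  refine ⟨convex_Ici 0, fun r₁ h₁ r₂ h₂ α β hα hβ hαβ => ?_⟩
  rw [Set.mem_Ici] at h₁ h₂
  have lub := fun r (hr : 0 ≤ r) => isLUB_worstCaseExpectation hN hΞ hdata hr hK hf
  refine le_of_forall_pos_le_add fun ε hε => ?_
  obtain ⟨_, ⟨Q₁, hQ₁, rfl⟩, hlt₁, -⟩ :=
    (lub r₁ h₁).exists_between (sub_lt_self _ hε)
  obtain ⟨_, ⟨Q₂, hQ₂, rfl⟩, hlt₂, -⟩ :=
    (lub r₂ h₂).exists_between (sub_lt_self _ hε)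
  have h := (lub (α * r₁ + β * r₂) (by positivity)).1
    ⟨_, mixture_mem_ambiguitySet h₁ h₂ hQ₁ hQ₂ hα hβ hαβ, rfl⟩
  have i₁ := (integrable_of_mem_ambiguitySet hN h₁ hf hQ₁).smul_measure
    (c := ENNReal.ofReal α) ENNReal.ofReal_ne_top
  have i₂ := (integrable_of_mem_ambiguitySet hN h₂ hf hQ₂).smul_measure
    (c := ENNReal.ofReal β) ENNReal.ofReal_ne_top
  simp only [integral_add_measure i₁ i₂, integral_smul_measure, ENNReal.toReal_ofReal hα,
    ENNReal.toReal_ofReal hβ, smul_eq_mul] at h ⊢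
  have e : ε = α * ε + β * ε := by rw [← add_mul, hαβ, one_mul]
  have d₁ := mul_le_mul_of_nonneg_left hlt₁.le hα
  have d₂ := mul_le_mul_of_nonneg_left hlt₂.le hβ
  linarith

/-- Strong duality with dual attainment. For a positive radius the multiplier `lam` is a
supergradient at `ρ` of the worst-case expectation as a function of the radius, tested against
empirical measures of displaced data points; for radius zero the Lipschitz constant will do. -/
theorem exists_dual_isLUB (hN : 1 ≤ N) (hΞ : MeasurableSet Ξ) (hdata : ∀ i, data i ∈ Ξ)
    (hρ : 0 ≤ ρ) (hK : 0 ≤ K) (hf : ∀ ξ ξ', |f ξ - f ξ'| ≤ K * ν (ξ - ξ')) :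
    ∃ (lam : ℝ) (s : Fin N → ℝ), 0 ≤ lam ∧ (∀ i, ∀ ξ ∈ Ξ, f ξ ≤ s i + lam * ν (ξ - data i)) ∧
      IsLUB ((fun Q => ∫ ξ, f ξ ∂Q) '' ambiguitySet ν Ξ data ρ)
        (lam * ρ + (1 / (N : ℝ)) * ∑ i, s i) := by
  have hne : Ξ.Nonempty := ⟨_, hdata ⟨0, hN⟩⟩
  have hNpos : (0 : ℝ) < N := by exact_mod_cast hN
  have lub := fun r (hr : 0 ≤ r) => isLUB_worstCaseExpectation hN hΞ hdata hr hK hf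
  -- weak duality makes every dual value an upper bound, so only the reverse inequality matters
  suffices h : ∃ (lam : ℝ) (s : Fin N → ℝ), 0 ≤ lam ∧
      (∀ i, ∀ ξ ∈ Ξ, f ξ ≤ s i + lam * ν (ξ - data i)) ∧
      lam * ρ + (1 / (N : ℝ)) * ∑ i, s i ≤ worstCaseExpectation ν Ξ data f ρ by
    obtain ⟨lam, s, hlam, hs, hle⟩ := h
    refine ⟨lam, s, hlam, hs, ?_, fun b hb => hle.trans ((lub ρ hρ).2 hb)⟩
    rintro _ ⟨Q, hQ, rfl⟩
    exact integral_le_of_mem_ambiguitySet hN hΞ hne hρ hf hlam hs hQ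
  rcases hρ.eq_or_lt with rfl | hρ'
  · refine ⟨K, fun i => f (data i), hK, fun i ξ _ => ?_, ?_⟩
    · linarith [le_abs_self (f ξ - f (data i)), hf ξ (data i)]
    · have h := (lub 0 le_rfl).1 ⟨_, empirical_data_mem_ambiguitySet hN hΞ hdata le_rfl, rfl⟩
      simp only [integral_empirical] at h
      simpa using h
  · obtain ⟨lam, hlam, hsup⟩ := exists_nonneg_supergradient
      (concaveOn_worstCaseExpectation hN hΞ hdata hK hf)
      (monotoneOn_worstCaseExpectation hN hΞ hdata hK hf) hρ'
    have hζ : ∀ ζ : Fin N → Sample n, (∀ i, ζ i ∈ Ξ) →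
        ∑ i, (f (ζ i) - lam * ν (ζ i - data i)) ≤
          N * (worstCaseExpectation ν Ξ data f ρ - lam * ρ) := fun ζ hζ => by
      have hr : 0 ≤ (1 / (N : ℝ)) * ∑ i, ν (ζ i - data i) :=
        mul_nonneg (by positivity) (Finset.sum_nonneg fun i _ => apply_nonneg ν _)
      have h1 := (lub _ hr).1 ⟨_, empirical_mem_ambiguitySet hN hΞ hζ, rfl⟩
      have h2 := h1.trans (hsup _ hr)
      simp only [integral_empirical] at h2
      rw [Finset.sum_sub_distrib, ← Finset.mul_sum, ← div_le_iff₀' hNpos]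
      rw [one_div_mul_eq_div, one_div_mul_eq_div] at h2
      rw [sub_div, mul_div_assoc]
      linarith
    obtain ⟨s, hs, hsum⟩ := exists_upperBounds_sum_le hne
      (fun i ξ => f ξ - lam * ν (ξ - data i)) hζ
    refine ⟨lam, s, hlam, fun i ξ hξ => by linarith [hs i ξ hξ], ?_⟩
    rw [← div_le_iff₀' hNpos] at hsum
    rw [one_div_mul_eq_div]
    linarith

end Duality

end RobustRegression

namespace RobustRegression

/-! ### The worst-case loss -/

section WorstCaseLoss

variable {n N : ℕ} {ν : Seminorm ℝ (Sample n)} {Ξ : Set (Sample n)} {data : Fin N → Sample n}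
  {ρ : ℝ} {L : ℝ → ℝ} {A : ℝ}

lemma biSup_coe_eq_of_isLUB {α : Type*} {S : Set α} {F : α → ℝ} {x : ℝ} (h : IsLUB (F '' S) x) :
    (⨆ a ∈ S, (F a : EReal)) = x := by
  refine le_antisymm (iSup₂_le fun a ha => EReal.coe_le_coe_iff.2 (h.1 ⟨a, ha, rfl⟩)) ?_
  obtain ⟨_, a₀, ha₀, rfl⟩ := h.nonempty
  have hle : ∀ a ∈ S, (F a : EReal) ≤ ⨆ a ∈ S, (F a : EReal) := fun a ha =>
    le_iSup₂ (f := fun a (_ : a ∈ S) => (F a : EReal)) a ha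
  generalize (⨆ a ∈ S, (F a : EReal)) = y at hle
  induction y with
  | bot => exact absurd (hle a₀ ha₀) (by simp)
  | top => exact le_top
  | coe y =>
    refine EReal.coe_le_coe_iff.2 (h.2 ?_)
    rintro _ ⟨a, ha, rfl⟩
    exact EReal.coe_le_coe_iff.1 (hle a ha)

lemma loss_eq (L : ℝ → ℝ) (w : EuclideanSpace ℝ (Fin n)) (ξ : Sample n) :
    loss L w ξ = L (pairing (w, -1) ξ) := by
  simp only [loss, pairing]
  congr 1
  ring

lemma abs_loss_sub_le (hν : ∀ v, ν v = 0 → v = 0) (hA : 0 ≤ A)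
    (hL : ∀ t t', |L t - L t'| ≤ A * |t - t'|) (w : EuclideanSpace ℝ (Fin n)) (ξ ξ' : Sample n) :
    |loss L w ξ - loss L w ξ'| ≤ A * dualNorm ν (w, -1) * ν (ξ - ξ') := by
  rw [loss_eq, loss_eq, mul_assoc]
  refine (hL _ _).trans (mul_le_mul_of_nonneg_left ?_ hA)
  rw [← pairing_sub_right]
  exact abs_pairing_le_dualNorm_mul ν hν _ _

end WorstCaseLoss

/-! ### Piecewise affine losses -/

section PiecewiseAffine

variable {n N J : ℕ} {ν : Seminorm ℝ (Sample n)} {Ξ : Set (Sample n)} {data : Fin N → Sample n}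
  {ρ : ℝ} {L : ℝ → ℝ} {a b : Fin J → ℝ}

lemma abs_sub_le_of_isGreatest (hmax : ∀ z, IsGreatest (Set.range fun j => a j * z + b j) (L z))
    (t t' : ℝ) : |L t - L t'| ≤ (∑ j, |a j|) * |t - t'| := by
  have key : ∀ t t', L t - L t' ≤ (∑ j, |a j|) * |t - t'| := fun t t' => by
    obtain ⟨j, hj⟩ := (hmax t).1
    have h1 := (hmax t').2 ⟨j, rfl⟩
    simp only at hj h1
    calc L t - L t' ≤ a j * (t - t') := by linarith
      _ ≤ |a j| * |t - t'| := (le_abs_self _).trans (abs_mul _ _).le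
      _ ≤ _ := mul_le_mul_of_nonneg_right
        (Finset.single_le_sum (f := fun j => |a j|) (fun _ _ => abs_nonneg _)
          (Finset.mem_univ j)) (abs_nonneg _)
  refine abs_sub_le_iff.2 ⟨key t t', ?_⟩
  rw [abs_sub_comm]
  exact key t' t

/-- The constraints of the finite program, with the support function unfolded into one real
inequality for each point of `Ξ`. -/
lemma mem_feasibleSet_iff (v : Decision n N J) :
    v ∈ feasibleSet ν Ξ data a b ↔ ∀ i j,
      (∀ ξ ∈ Ξ, pairing (a j • ((v.1, -1) : Sample n) - v.2.2.2 i j) ξ +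
        (b j + pairing (v.2.2.2 i j) (data i)) ≤ v.2.2.1 i) ∧
      dualNorm ν (v.2.2.2 i j) ≤ v.2.1 := by
  refine forall₂_congr fun i j => and_congr ?_ Iff.rfl
  have e : ((a j • v.1 - (v.2.2.2 i j).1, -a j - (v.2.2.2 i j).2) : Sample n) =
      a j • ((v.1, -1) : Sample n) - v.2.2.2 i j := by
    ext <;> simp
  rw [e, ← EReal.le_sub_iff_add_le (.inl (EReal.coe_ne_bot _)) (.inl (EReal.coe_ne_top _)),
    ← EReal.coe_sub, supportFunction, iSup₂_le_iff]
  refine forall₂_congr fun ξ _ => ?_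
  rw [EReal.coe_le_coe_iff, pairing_comm, le_sub_iff_add_le]
  simp only [pairing, add_assoc]

lemma convexOn_objective (hν : ∀ v, ν v = 0 → v = 0) :
    ConvexOn ℝ (feasibleSet ν Ξ data a b) (objective (n := n) (N := N) (J := J) ρ) := by
  refine ⟨fun v hv v' hv' α β hα hβ hαβ => ?_, fun v _ v' _ α β _ _ _ => ?_⟩
  · rw [mem_feasibleSet_iff] at hv hv' ⊢
    refine fun i j => ⟨fun ξ hξ => ?_, ?_⟩
    · have h1 := mul_le_mul_of_nonneg_left ((hv i j).1 ξ hξ) hα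
      have h2 := mul_le_mul_of_nonneg_left ((hv' i j).1 ξ hξ) hβ
      have e : ((α • v.1 + β • v'.1, -1) : Sample n) =
          α • ((v.1, -1) : Sample n) + β • ((v'.1, -1) : Sample n) := by
        ext
        · simp
        · simp only [Prod.snd_add, Prod.smul_snd, smul_eq_mul]
          linarith
      have e' : b j = α * b j + β * b j := by rw [← add_mul, hαβ, one_mul]
      simp only [Prod.fst_add, Prod.smul_fst, Prod.snd_add, Prod.smul_snd, Pi.add_apply,
        Pi.smul_apply, smul_eq_mul, e, pairing_sub_left, pairing_add_left, pairing_smul_left]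
        at h1 h2 ⊢
      linarith
    · exact ((convexOn_dualNorm ν hν).2 trivial trivial hα hβ hαβ).trans (add_le_add
        (mul_le_mul_of_nonneg_left (hv i j).2 hα) (mul_le_mul_of_nonneg_left (hv' i j).2 hβ))
  · simp only [objective, Prod.snd_add, Prod.smul_snd, Prod.fst_add, Prod.smul_fst, Pi.add_apply,
      Pi.smul_apply, smul_eq_mul, Finset.sum_add_distrib, ← Finset.mul_sum]
    exact le_of_eq (by ring)

/-- A feasible point of the finite program provides a majorant of the loss by cones centred at the
data points. -/
lemma loss_le_of_mem_feasibleSet (hν : ∀ v, ν v = 0 → v = 0)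
    (hmax : ∀ z, IsGreatest (Set.range fun j => a j * z + b j) (L z)) {v : Decision n N J}
    (hv : v ∈ feasibleSet ν Ξ data a b) (i : Fin N) {ξ : Sample n} (hξ : ξ ∈ Ξ) :
    loss L v.1 ξ ≤ v.2.2.1 i + v.2.1 * ν (ξ - data i) := by
  rw [mem_feasibleSet_iff] at hv
  obtain ⟨j, hj⟩ := (hmax (pairing (v.1, -1) ξ)).1
  simp only at hj
  have h1 := (hv i j).1 ξ hξ
  have h2 := (pairing_le_dualNorm_mul ν hν (v.2.2.2 i j) (ξ - data i)).trans
    (mul_le_mul_of_nonneg_right (hv i j).2 (apply_nonneg ν _))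
  rw [pairing_sub_left, pairing_smul_left] at h1
  rw [pairing_sub_right] at h2
  rw [loss_eq, ← hj]
  linarith

lemma nonneg_of_mem_feasibleSet (hN : 1 ≤ N) (hν : ∀ v, ν v = 0 → v = 0)
    (hmax : ∀ z, IsGreatest (Set.range fun j => a j * z + b j) (L z)) {v : Decision n N J}
    (hv : v ∈ feasibleSet ν Ξ data a b) : 0 ≤ v.2.1 := by
  obtain ⟨j, -⟩ := (hmax 0).1
  exact (dualNorm_nonneg ν hν _).trans (hv ⟨0, hN⟩ j).2

lemma worstCaseLoss_le_objective (hN : 1 ≤ N) (hν : ∀ v, ν v = 0 → v = 0) (hΞ : MeasurableSet Ξ)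
    (hdata : ∀ i, data i ∈ Ξ) (hρ : 0 ≤ ρ)
    (hmax : ∀ z, IsGreatest (Set.range fun j => a j * z + b j) (L z)) {v : Decision n N J}
    (hv : v ∈ feasibleSet ν Ξ data a b) :
    worstCaseLoss ν Ξ data ρ L v.1 ≤ (objective ρ v : ℝ) := by
  have hA : 0 ≤ ∑ j, |a j| := Finset.sum_nonneg fun _ _ => abs_nonneg _
  exact iSup₂_le fun Q hQ => EReal.coe_le_coe_iff.2 <|
    integral_le_of_mem_ambiguitySet hN hΞ ⟨_, hdata ⟨0, hN⟩⟩ hρ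
      (abs_loss_sub_le hν hA (abs_sub_le_of_isGreatest hmax) v.1)
      (nonneg_of_mem_feasibleSet hN hν hmax hv)
      (fun i _ hξ => loss_le_of_mem_feasibleSet hν hmax hv i hξ) hQ

/-- For fixed `w` the finite program attains the worst-case loss: the conic majorant from strong
duality is turned into vectors `p i j` by the sandwich theorem, one affine piece at a time. -/
lemma exists_objective_eq_worstCaseLoss (hN : 1 ≤ N) (hν : ∀ v, ν v = 0 → v = 0)
    (hΞ : MeasurableSet Ξ) (hconv : Convex ℝ Ξ) (hdata : ∀ i, data i ∈ Ξ) (hρ : 0 ≤ ρ)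
    (hmax : ∀ z, IsGreatest (Set.range fun j => a j * z + b j) (L z))
    (w : EuclideanSpace ℝ (Fin n)) :
    ∃ v ∈ feasibleSet ν Ξ data a b, v.1 = w ∧
      worstCaseLoss ν Ξ data ρ L w = (objective ρ v : ℝ) := by
  have hA : 0 ≤ ∑ j, |a j| := Finset.sum_nonneg fun _ _ => abs_nonneg _
  obtain ⟨lam, s, hlam, hs, hlub⟩ := exists_dual_isLUB hN hΞ hdata hρ
    (mul_nonneg hA (dualNorm_nonneg ν hν (w, -1)))
    (abs_loss_sub_le hν hA (abs_sub_le_of_isGreatest hmax) w)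
  have hp : ∀ i j, ∃ p : Sample n, dualNorm ν p ≤ lam ∧ ∀ ξ ∈ Ξ,
      pairing (a j • ((w, -1) : Sample n) - p) ξ + (b j + pairing p (data i)) ≤ s i :=
    fun i j => exists_dualNorm_le_of_affine_le ν hν hconv ⟨_, hdata i⟩ _ _ hlam fun ξ hξ => by
      have h := (hmax (pairing (w, -1) ξ)).2 ⟨j, rfl⟩
      rw [pairing_smul_left]
      exact h.trans ((loss_eq L w ξ).ge.trans (hs i ξ hξ))
  choose p hp1 hp2 using hp
  exact ⟨(w, lam, s, p), (mem_feasibleSet_iff _).2 fun i j => ⟨hp2 i j, hp1 i j⟩, rfl,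
    biSup_coe_eq_of_isLUB hlub⟩

end PiecewiseAffine

/-! ### Lipschitz losses -/

section Lipschitz

variable {n N : ℕ} {ν : Seminorm ℝ (Sample n)} {data : Fin N → Sample n} {ρ : ℝ} {L : ℝ → ℝ}

lemma lipModulus_nonneg (L : ℝ → ℝ) : 0 ≤ lipModulus L :=
  Real.sSup_nonneg (by rintro _ ⟨t, t', -, rfl⟩; positivity)

lemma abs_sub_le_lipModulus_mul {K : NNReal} (hK : LipschitzWith K L) (t t' : ℝ) :
    |L t - L t'| ≤ lipModulus L * |t - t'| := by
  rcases eq_or_ne t t' with rfl | hne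
  · simp
  have hpos : 0 < |t - t'| := abs_pos.2 (sub_ne_zero.2 hne)
  rw [← div_le_iff₀ hpos]
  refine le_csSup ⟨K, ?_⟩ ⟨t, t', hne, rfl⟩
  rintro _ ⟨u, u', hu, rfl⟩
  rw [div_le_iff₀ (abs_pos.2 (sub_ne_zero.2 hu))]
  simpa [Real.dist_eq] using hK.dist_le_mul u u'

lemma lipModulus_le {κ : ℝ} (h : ∀ t t', |L t - L t'| ≤ κ * |t - t'|) : lipModulus L ≤ κ := by
  refine csSup_le ⟨_, 0, 1, zero_ne_one, rfl⟩ ?_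
  rintro _ ⟨t, t', ht, rfl⟩
  rw [div_le_iff₀ (abs_pos.2 (sub_ne_zero.2 ht))]
  exact h t t'

/-- A convex function on the line growing at most at rate `κ` has Lipschitz constant `κ`: a secant
of larger slope would, by convexity, be followed forever. -/
lemma abs_sub_le_of_convexOn_of_le (hL : ConvexOn ℝ Set.univ L) {s κ m : ℝ} (hκ : 0 ≤ κ)
    (h : ∀ t, L t ≤ s + κ * |t - m|) (t t' : ℝ) : |L t - L t'| ≤ κ * |t - t'| := by
  have key : ∀ t t', L t' - L t ≤ κ * |t' - t| := fun t t' => by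
    by_contra hcon
    have hd : 0 < L t' - L t - κ * |t' - t| := by linarith
    obtain ⟨k, hk⟩ := exists_nat_gt
      ((s + κ * |t - m| - L t) / (L t' - L t - κ * |t' - t|))
    rw [div_lt_iff₀ hd] at hk
    have hk0 : (0 : ℝ) < k + 1 := by positivity
    have hconv := hL.2 (Set.mem_univ t) (Set.mem_univ (t + (k + 1) * (t' - t)))
      (show (0 : ℝ) ≤ k / (k + 1) by positivity) (show (0 : ℝ) ≤ 1 / (k + 1) by positivity)
      (by field_simp)
    have e : (k / (k + 1) : ℝ) • t + (1 / (k + 1) : ℝ) • (t + (k + 1) * (t' - t)) = t' := by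
      simp only [smul_eq_mul]
      field_simp
      ring
    rw [e, smul_eq_mul, smul_eq_mul] at hconv
    have hconv' : (k + 1) * L t' ≤ k * L t + L (t + (k + 1) * (t' - t)) := by
      have := mul_le_mul_of_nonneg_left hconv hk0.le
      have e' : ((k : ℝ) + 1) * (k / (k + 1) * L t + 1 / (k + 1) * L (t + (k + 1) * (t' - t))) =
          k * L t + L (t + (k + 1) * (t' - t)) := by
        field_simp
      linarith
    have hgrow := h (t + (k + 1) * (t' - t))
    have habs : |t + (k + 1) * (t' - t) - m| ≤ |t - m| + (k + 1) * |t' - t| := by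
      calc |t + (k + 1) * (t' - t) - m| = |(t - m) + (k + 1) * (t' - t)| := by congr 1; ring
        _ ≤ |t - m| + |(k + 1) * (t' - t)| := abs_add_le _ _
        _ = _ := by rw [abs_mul, abs_of_pos hk0]
    have := mul_le_mul_of_nonneg_left habs hκ
    linarith
  refine abs_sub_le_iff.2 ⟨key t' t, ?_⟩
  rw [abs_sub_comm]
  exact key t t'

/-- On the whole space a conic majorant of the loss must be at least as steep as the regularizer:
along every ray `lam` bounds the growth of the convex function `L`. -/
lemma lipModulus_mul_dualNorm_le (hν : ∀ v, ν v = 0 → v = 0) (hL : ConvexOn ℝ Set.univ L)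
    {w : EuclideanSpace ℝ (Fin n)} {ξ₀ : Sample n} {s lam : ℝ} (hlam : 0 ≤ lam)
    (h : ∀ ξ, loss L w ξ ≤ s + lam * ν (ξ - ξ₀)) :
    lipModulus L * dualNorm ν (w, -1) ≤ lam := by
  rcases (lipModulus_nonneg L).eq_or_lt with h0 | hpos
  · rwa [← h0, zero_mul]
  rw [← le_div_iff₀' hpos, dualNorm_le_iff ν hν]
  intro z hz
  rw [le_div_iff₀' hpos]
  rcases le_or_gt (pairing (w, -1) z) 0 with hc | hc
  · exact (mul_nonpos_of_nonneg_of_nonpos hpos.le hc).trans hlam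
  rw [← le_div_iff₀ hc]
  refine lipModulus_le (abs_sub_le_of_convexOn_of_le hL (s := s) (m := pairing (w, -1) ξ₀)
    (by positivity) fun t => ?_)
  set c := pairing ((w, -1) : Sample n) z with hcdef
  have h1 := h (ξ₀ + ((t - pairing (w, -1) ξ₀) / c) • z)
  rw [loss_eq, pairing_add_right, pairing_smul_right, ← hcdef, div_mul_cancel₀ _ hc.ne',
    add_sub_cancel, add_sub_cancel_left, map_smul_eq_mul, Real.norm_eq_abs, abs_div,
    abs_of_pos hc] at h1
  refine h1.trans (add_le_add le_rfl ?_)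
  calc lam * (|t - pairing (w, -1) ξ₀| / c * ν z)
      ≤ lam * (|t - pairing (w, -1) ξ₀| / c * 1) := by gcongr
    _ = _ := by ring

lemma worstCaseLoss_univ_eq (hN : 1 ≤ N) (hν : ∀ v, ν v = 0 → v = 0) (hρ : 0 ≤ ρ)
    (hL : ConvexOn ℝ Set.univ L) {K : NNReal} (hK : LipschitzWith K L)
    (w : EuclideanSpace ℝ (Fin n)) :
    worstCaseLoss ν Set.univ data ρ L w = (regularizedLoss ν data ρ L w : ℝ) := by
  have hc : 0 ≤ lipModulus L * dualNorm ν (w, -1) :=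
    mul_nonneg (lipModulus_nonneg L) (dualNorm_nonneg ν hν _)
  have hf := abs_loss_sub_le hν (lipModulus_nonneg L) (abs_sub_le_lipModulus_mul hK) w
  have hdata : ∀ i, data i ∈ (Set.univ : Set (Sample n)) := fun _ => trivial
  obtain ⟨lam, s, hlam, hs, hlub⟩ := exists_dual_isLUB hN MeasurableSet.univ hdata hρ hc hf
  have h1 : lam * ρ + (1 / (N : ℝ)) * ∑ i, s i ≤ regularizedLoss ν data ρ L w := hlub.2 <| by
    rintro _ ⟨Q, hQ, rfl⟩
    refine (integral_le_empirical_add hN MeasurableSet.univ Set.univ_nonempty hρ hc hf hQ).trans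
      (le_of_eq ?_)
    rw [regularizedLoss]
    ring
  have h2 : regularizedLoss ν data ρ L w ≤ lam * ρ + (1 / (N : ℝ)) * ∑ i, s i := by
    have h3 := mul_le_mul_of_nonneg_right
      (lipModulus_mul_dualNorm_le hν hL hlam fun ξ => hs ⟨0, hN⟩ ξ trivial) hρ
    have h4 : (1 / (N : ℝ)) * ∑ i, loss L w (data i) ≤ (1 / (N : ℝ)) * ∑ i, s i :=
      mul_le_mul_of_nonneg_left
        (Finset.sum_le_sum fun i _ => by simpa using hs i (data i) trivial) (by positivity)
    rw [regularizedLoss]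
    linarith
  rw [worstCaseLoss, biSup_coe_eq_of_isLUB hlub, le_antisymm h1 h2]

lemma convexOn_regularizedLoss (hν : ∀ v, ν v = 0 → v = 0) (hρ : 0 ≤ ρ)
    (hL : ConvexOn ℝ Set.univ L) : ConvexOn ℝ Set.univ (regularizedLoss ν data ρ L) := by
  refine ⟨convex_univ, fun w _ w' _ α β hα hβ hαβ => ?_⟩
  have e : ((α • w + β • w', -1) : Sample n) =
      α • ((w, -1) : Sample n) + β • ((w', -1) : Sample n) := by
    ext
    · simp
    · simp only [Prod.snd_add, Prod.smul_snd, smul_eq_mul]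
      linarith
  have h1 : ∑ i, loss L (α • w + β • w') (data i) ≤
      α * ∑ i, loss L w (data i) + β * ∑ i, loss L w' (data i) := by
    rw [Finset.mul_sum, Finset.mul_sum, ← Finset.sum_add_distrib]
    refine Finset.sum_le_sum fun i _ => ?_
    rw [loss_eq, e, pairing_add_left, pairing_smul_left, pairing_smul_left, loss_eq, loss_eq]
    exact hL.2 trivial trivial hα hβ hαβ
  have h2 : dualNorm ν (α • w + β • w', -1) ≤
      α * dualNorm ν (w, -1) + β * dualNorm ν (w', -1) := by
    rw [e]
    exact (convexOn_dualNorm ν hν).2 trivial trivial hα hβ hαβ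
  have h3 := mul_le_mul_of_nonneg_left h1 (show 0 ≤ 1 / (N : ℝ) by positivity)
  have h4 := mul_le_mul_of_nonneg_left h2 (mul_nonneg hρ (lipModulus_nonneg L))
  simp only [regularizedLoss, smul_eq_mul]
  linarith

end Lipschitz

end RobustRegression

theorem mainTheorem1 {n N : ℕ} (hN : 1 ≤ N)
    (ν : Seminorm ℝ (RobustRegression.Sample n)) (hν : ∀ v, ν v = 0 → v = 0)
    (Ξ : Set (RobustRegression.Sample n)) (hΞ_closed : IsClosed Ξ) (hΞ_convex : Convex ℝ Ξ)
    (data : Fin N → RobustRegression.Sample n) (hdata : ∀ i, data i ∈ Ξ)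
    (ρ : ℝ) (hρ : 0 ≤ ρ)
    (L : ℝ → ℝ) (hL : ConvexOn ℝ Set.univ L) :
    -- (i) piecewise affine loss
    (∀ (J : ℕ) (a b : Fin J → ℝ),
      (∀ z : ℝ, IsGreatest (Set.range fun j => a j * z + b j) (L z)) →
        -- all expectations exist
        (∀ (w : EuclideanSpace ℝ (Fin n)), ∀ Q ∈ RobustRegression.ambiguitySet ν Ξ data ρ,
          MeasureTheory.Integrable (RobustRegression.loss L w) Q) ∧
        -- for fixed `w`, the worst-case loss is the partial infimum over the other variables
        (∀ w : EuclideanSpace ℝ (Fin n),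
          RobustRegression.worstCaseLoss ν Ξ data ρ L w =
            ⨅ v ∈ {v ∈ RobustRegression.feasibleSet ν Ξ data a b | v.1 = w},
              ((RobustRegression.objective ρ v : ℝ) : EReal)) ∧
        -- the optimal values agree
        (⨅ w, RobustRegression.worstCaseLoss ν Ξ data ρ L w) =
          (⨅ v ∈ RobustRegression.feasibleSet ν Ξ data a b,
            ((RobustRegression.objective ρ v : ℝ) : EReal)) ∧
        -- the optimal hypotheses agree
        (∀ w : EuclideanSpace ℝ (Fin n),
          IsMinOn (RobustRegression.worstCaseLoss ν Ξ data ρ L) Set.univ w ↔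
            ∃ v ∈ RobustRegression.feasibleSet ν Ξ data a b, v.1 = w ∧
              IsMinOn (RobustRegression.objective ρ)
                (RobustRegression.feasibleSet ν Ξ data a b) v) ∧
        -- the finite program is convex
        ConvexOn ℝ (RobustRegression.feasibleSet ν Ξ data a b)
          (RobustRegression.objective (n := n) (N := N) (J := J) ρ)) ∧
    -- (ii) Lipschitz continuous loss and unrestricted samples
    (Ξ = Set.univ → (∃ K : NNReal, LipschitzWith K L) →
        -- all expectations exist
        (∀ (w : EuclideanSpace ℝ (Fin n)), ∀ Q ∈ RobustRegression.ambiguitySet ν Ξ data ρ,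
          MeasureTheory.Integrable (RobustRegression.loss L w) Q) ∧
        -- the objective functions agree
        (∀ w : EuclideanSpace ℝ (Fin n),
          RobustRegression.worstCaseLoss ν Ξ data ρ L w =
            ((RobustRegression.regularizedLoss ν data ρ L w : ℝ) : EReal)) ∧
        -- the optimal values agree
        (⨅ w, RobustRegression.worstCaseLoss ν Ξ data ρ L w) =
          (⨅ w, ((RobustRegression.regularizedLoss ν data ρ L w : ℝ) : EReal)) ∧
        -- the optimal hypotheses agree
        (∀ w : EuclideanSpace ℝ (Fin n),
          IsMinOn (RobustRegression.worstCaseLoss ν Ξ data ρ L) Set.univ w ↔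
            IsMinOn (RobustRegression.regularizedLoss ν data ρ L) Set.univ w) ∧
        -- the regularized problem is convex
        ConvexOn ℝ Set.univ (RobustRegression.regularizedLoss ν data ρ L)) := by
  have hΞm : MeasurableSet Ξ := hΞ_closed.measurableSet
  refine ⟨fun J a b hmax => ?_, ?_⟩
  · have hle : ∀ v ∈ RobustRegression.feasibleSet ν Ξ data a b,
        RobustRegression.worstCaseLoss ν Ξ data ρ L v.1 ≤ (RobustRegression.objective ρ v : ℝ) :=
      fun v hv => RobustRegression.worstCaseLoss_le_objective hN hν hΞm hdata hρ hmax hv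
    have hatt := RobustRegression.exists_objective_eq_worstCaseLoss hN hν hΞm hΞ_convex hdata hρ
      hmax
    refine ⟨fun w Q hQ => ?_, fun w => ?_, ?_, fun w => ?_,
      RobustRegression.convexOn_objective hν⟩
    · exact RobustRegression.integrable_of_mem_ambiguitySet hN hρ
        (RobustRegression.abs_loss_sub_le hν (Finset.sum_nonneg fun _ _ => abs_nonneg _)
          (RobustRegression.abs_sub_le_of_isGreatest hmax) w) hQ
    · refine le_antisymm (le_iInf₂ fun v hv => hv.2 ▸ hle v hv.1) ?_
      obtain ⟨v, hv, hvw, he⟩ := hatt w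
      rw [he]
      exact iInf₂_le v ⟨hv, hvw⟩
    · refine le_antisymm (le_iInf₂ fun v hv => (iInf_le _ v.1).trans (hle v hv))
        (le_iInf fun w => ?_)
      obtain ⟨v, hv, -, he⟩ := hatt w
      rw [he]
      exact iInf₂_le v hv
    · constructor
      · intro hmin
        obtain ⟨v, hv, hvw, he⟩ := hatt w
        refine ⟨v, hv, hvw, fun v' hv' => EReal.coe_le_coe_iff.1 ?_⟩
        rw [← he]
        exact (hmin (Set.mem_univ v'.1)).trans (hle v' hv')
      · rintro ⟨v, hv, rfl, hmin⟩ w' -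
        obtain ⟨v', hv', -, he⟩ := hatt w'
        exact (hle v hv).trans ((EReal.coe_le_coe_iff.2 (hmin hv')).trans he.ge)
  · rintro rfl ⟨K, hK⟩
    have heq := RobustRegression.worstCaseLoss_univ_eq (data := data) hN hν hρ hL hK
    refine ⟨fun w Q hQ => ?_, heq, iInf_congr heq, fun w => ?_,
      RobustRegression.convexOn_regularizedLoss hν hρ hL⟩
    · exact RobustRegression.integrable_of_mem_ambiguitySet hN hρ
        (RobustRegression.abs_loss_sub_le hν (RobustRegression.lipModulus_nonneg L)
          (RobustRegression.abs_sub_le_lipModulus_mul hK) w) hQ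
    · simp only [isMinOn_iff, heq, EReal.coe_le_coe_iff]
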